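/- Let $(\Omega,\mathcal F,P)$ be a probability space, let $(\varepsilon_i)_{i\ge 1}$ be real random variables on it and let $b=(b_i)_{i\ge1}$ be a real sequence. Assume that 1. the $\varepsilon_i$ are independent and square-integrable, with $E(\varepsilon_i)=0$ and $E(\varepsilon_i^2)=1$ for all $i\ge1$; 2. $b\in\ell_2$, i.e. $\sum_{i\ge1} b_i^2<\infty$; 3. $P(\varepsilon_i>b_i)>0$ and $P(\varepsilon_i<b_i)>0$ for all $i\ge1$; 4. $\sup_{i\ge1}E(|\varepsilon_i|^3)<\infty$. For $h\in\ell_2$ write $\langle h,\varepsilon-b\rangle:=\sum_{i=1}^\infty h_i(\varepsilon_i-b_i)$, the limit in $L^2(P)$ of the partial sums $\sum_{i=1}^n h_i(\varepsilon_i-b_i)$. Then: (a) This limit exists for every $h\in\ell_2$. (b) There is $\alpha>0$ such that $P(\langle h,\varepsilon-b\rangle<-\alpha)>\alpha$ for every $h\in\ell_2$ with $\|h\|_{\ell_2}=1$. (c) For every $\alpha>0$ with the property in (b), and all $y\in\mathbb R$ and $h\in\ell_2$: if $y+\langle h,\varepsilon-b\rangle\ge0$ almost surely, then $\|h\|_{\ell_2}\le|y|/\alpha$.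 -/

import Mathlib

open MeasureTheory ProbabilityTheory Filter Topology
open scoped ENNReal

/-- `V` is (a version of) the random variable `⟨h, ε - b⟩ = ∑ i, h i * (ε i - b i)`: a
square-integrable random variable that is the limit in `L²(P)` of the sequence of partial sums.
Assets are indexed by `{0, 1, …}` instead of `{1, 2, …}`. -/
def IsPortfolioValue {Ω : Type*} [MeasurableSpace Ω] (P : Measure Ω)
    (ε : ℕ → Ω → ℝ) (b : ℕ → ℝ) (h : ℕ → ℝ) (V : Ω → ℝ) : Prop :=
  MemLp V 2 P ∧
    Tendsto
      (fun n : ℕ => eLpNorm (fun ω => (∑ i ∈ Finset.range n, h i * (ε i ω - b i)) - V ω) 2 P)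
      atTop (𝓝 0)

/-- The bound `P(⟨h, ε - b⟩ < -α) > α` for all `h` in the unit sphere of `ℓ²`. -/
def QuantitativeNoArbitrage {Ω : Type*} [MeasurableSpace Ω] (P : Measure Ω)
    (ε : ℕ → Ω → ℝ) (b : ℕ → ℝ) (α : ℝ) : Prop :=
  ∀ h : lp (fun _ : ℕ => ℝ) 2, ‖h‖ = 1 →
    ∀ V : Ω → ℝ, IsPortfolioValue P ε b h V → α < P.real {ω | V ω < -α}

/-! The heart is (b). A centred sum `S = ∑ h i * ε i` with standard deviation `σ` satisfies `E|S|³ ≤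
K σ³`, where `K = 3 + M` and `M` bounds the third moments (`integral_abs_sum_mul_pow_three_le`). So
`S` cannot concentrate near zero, and it falls below `-σ/(4K)` with probability at least `1/(16K²)`.
Beyond some index `N` the drift `b` has norm at most `1/(8K)`, and by Cauchy–Schwarz it eats at most
half of this loss. Each of the first `N` assets loses a fixed fraction of its position with positive
probability. Independence multiplies these probabilities, giving bounds uniform in `h` and in the
number of assets (`exists_forall_le_measureReal_sum_range`), which survive the `L²` limit. For (a),
the `ε i` are orthonormal in `L²`. For (c), rescale `h` to the unit sphere. -/

/-! ### Moments of independent sums. -/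

theorem abs_add_pow_three_le (x y : ℝ) :
    |x + y| ^ 3 ≤ |x| ^ 3 + 3 * (x * |x| * y) + 3 * (|x| * y ^ 2) + |y| ^ 3 := by
  have key : ∀ x y : ℝ, 0 ≤ x →
      |x + y| ^ 3 ≤ |x| ^ 3 + 3 * (x * |x| * y) + 3 * (|x| * y ^ 2) + |y| ^ 3 := by
    intro x y hx
    rw [abs_of_nonneg hx]
    rcases le_total 0 (x + y) with h | h
    · rw [abs_of_nonneg h]
      have : y ^ 3 ≤ |y| ^ 3 := by rw [← abs_pow]; exact le_abs_self _
      nlinarith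
    · have hy : y ≤ 0 := by linarith
      rw [abs_of_nonpos h, abs_of_nonpos hy]
      -- The two sides differ by `2x((x + 3y/2)² + 3y²/4)`.
      nlinarith [mul_nonneg hx (sq_nonneg (x + 3 / 2 * y)), mul_nonneg hx (sq_nonneg y)]
  rcases le_total 0 x with hx | hx
  · exact key x y hx
  · have h := key (-x) (-y) (by linarith)
    rw [← neg_add, abs_neg, abs_neg, abs_neg] at h
    linarith [h]

section

variable {Ω : Type*} [MeasurableSpace Ω] {P : Measure Ω}

theorem pow_card_le_measureReal_forall_mem {ι : Type*} {ε : ι → Ω → ℝ}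
    (hind : iIndepFun ε P) (s : Finset ι) {B : ι → Set ℝ} (hB : ∀ i, MeasurableSet (B i))
    {δ : ℝ} (hδ : 0 ≤ δ) (h : ∀ i ∈ s, δ ≤ P.real (ε i ⁻¹' B i)) :
    δ ^ s.card ≤ P.real {ω | ∀ i ∈ s, ε i ω ∈ B i} := by
  have he : {ω | ∀ i ∈ s, ε i ω ∈ B i} = ⋂ i ∈ s, ε i ⁻¹' B i := by
    ext ω; simp
  rw [he, measureReal_def, hind.measure_inter_preimage_eq_mul s fun i _ => hB i,
    ENNReal.toReal_prod, ← Finset.prod_const]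
  exact Finset.prod_le_prod (fun _ _ => hδ) h

variable [IsProbabilityMeasure P]

theorem integral_abs_le_of_integral_sq_le {S : Ω → ℝ} (hS : MemLp S 2 P) {σ : ℝ} (hσ : 0 ≤ σ)
    (h : ∫ ω, S ω ^ 2 ∂P ≤ σ ^ 2) : ∫ ω, |S ω| ∂P ≤ σ := by
  have hi : Integrable (fun ω => |S ω|) P := (hS.integrable one_le_two).abs
  set m := ∫ ω, |S ω| ∂P with hm
  have h1 : ∫ ω, (2 * m * |S ω| - m ^ 2) ∂P ≤ ∫ ω, S ω ^ 2 ∂P := by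
    refine integral_mono ((hi.const_mul _).sub (integrable_const _)) hS.integrable_sq ?_
    intro ω
    have := sq_nonneg (|S ω| - m)
    have h2 := sq_abs (S ω)
    simp only
    nlinarith
  rw [integral_sub (hi.const_mul _) (integrable_const _), integral_const_mul, ← hm] at h1
  simp only [integral_const, probReal_univ, one_smul] at h1
  exact abs_le_of_sq_le_sq' (by nlinarith) hσ |>.2

theorem integral_sum_sq_of_iIndepFun {ι : Type*} {Y : ι → Ω → ℝ} (h2 : ∀ i, MemLp (Y i) 2 P)
    (hind : iIndepFun Y P) (hmean : ∀ i, ∫ ω, Y i ω ∂P = 0) (s : Finset ι) :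
    ∫ ω, (∑ i ∈ s, Y i ω) ^ 2 ∂P = ∑ i ∈ s, ∫ ω, Y i ω ^ 2 ∂P := by
  have hv := IndepFun.variance_sum (μ := P) (X := Y) (s := s) (fun i _ => h2 i)
    (fun i _ j _ hij => hind.indepFun hij)
  have hS : MemLp (∑ i ∈ s, Y i) 2 P := memLp_finsetSum' s (fun i _ => h2 i)
  rw [variance_of_integral_eq_zero hS.aestronglyMeasurable.aemeasurable] at hv
  · simp only [Finset.sum_apply] at hv
    rw [hv]
    refine Finset.sum_congr rfl fun i _ => ?_
    exact variance_of_integral_eq_zero (h2 i).aestronglyMeasurable.aemeasurable (hmean i)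
  · simp only [Finset.sum_apply]
    rw [integral_finsetSum _ fun i _ => (h2 i).integrable one_le_two]
    simp [hmean]

/-- Add one summand at a time: in `abs_add_pow_three_le` the term linear in the new variable has
mean zero, and the quadratic one factors, with `E|S| ≤ σ`. Keeping `σ` fixed along the induction
lets the increments add up. -/
theorem integral_abs_sum_pow_three_le {ι : Type*} {Y : ι → Ω → ℝ} (hmeas : ∀ i, Measurable (Y i))
    (h3 : ∀ i, MemLp (Y i) 3 P) (hind : iIndepFun Y P) (hmean : ∀ i, ∫ ω, Y i ω ∂P = 0)
    {σ : ℝ} (hσ : 0 ≤ σ) (s : Finset ι) (hs : ∑ i ∈ s, ∫ ω, Y i ω ^ 2 ∂P ≤ σ ^ 2) :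
    ∫ ω, |∑ i ∈ s, Y i ω| ^ 3 ∂P ≤
      3 * σ * ∑ i ∈ s, ∫ ω, Y i ω ^ 2 ∂P + ∑ i ∈ s, ∫ ω, |Y i ω| ^ 3 ∂P := by
  classical
  have h2 : ∀ i, MemLp (Y i) 2 P := fun i => (h3 i).mono_exponent (by norm_num)
  have h3i : ∀ {f : Ω → ℝ}, MemLp f 3 P → Integrable (fun ω => |f ω| ^ 3) P := fun hf => by
    simpa using hf.integrable_norm_pow (p := 3) (by norm_num)
  induction s using Finset.induction_on with
  | empty => simp
  | insert k s hk ih =>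
    rw [Finset.sum_insert hk] at hs
    have hk2 : 0 ≤ ∫ ω, Y k ω ^ 2 ∂P := integral_nonneg fun ω => sq_nonneg _
    have hs' : ∑ i ∈ s, ∫ ω, Y i ω ^ 2 ∂P ≤ σ ^ 2 := by linarith
    have ih := ih hs'
    set S : Ω → ℝ := fun ω => ∑ i ∈ s, Y i ω with hSdef
    have hS3 : MemLp S 3 P := memLp_finsetSum s fun i _ => h3 i
    have hS2 : MemLp S 2 P := hS3.mono_exponent (by norm_num)
    have hindS : IndepFun S (Y k) P := by
      have := hind.indepFun_finsetSum_of_notMem hmeas hk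
      convert this using 1
      ext ω
      simp [hSdef]
    have hE : ∫ ω, |S ω| ∂P ≤ σ := by
      refine integral_abs_le_of_integral_sq_le hS2 hσ ?_
      rw [hSdef, integral_sum_sq_of_iIndepFun h2 hind hmean]
      exact hs'
    have hi1 : IndepFun (fun ω => S ω * |S ω|) (Y k) P :=
      hindS.comp (φ := fun x : ℝ => x * |x|) (ψ := id) (by fun_prop) measurable_id
    have hi2 : IndepFun (fun ω => |S ω|) (fun ω => Y k ω ^ 2) P :=
      hindS.comp (φ := fun x : ℝ => |x|) (ψ := fun x => x ^ 2) (by fun_prop) (by fun_prop)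
    have hSS : Integrable (fun ω => S ω * |S ω|) P := hS2.integrable_mul hS2.abs
    have hSa : Integrable (fun ω => |S ω|) P := (hS2.integrable one_le_two).abs
    have hYi := (h2 k).integrable one_le_two
    have hYs := (h2 k).integrable_sq
    have hm1 : Integrable (fun ω => S ω * |S ω| * Y k ω) P := hi1.integrable_mul hSS hYi
    have hm2 : Integrable (fun ω => |S ω| * Y k ω ^ 2) P := hi2.integrable_mul hSa hYs
    have e1 : ∫ ω, S ω * |S ω| * Y k ω ∂P = 0 := by
      rw [hi1.integral_fun_mul_eq_mul_integral hSS.aestronglyMeasurable hYi.aestronglyMeasurable,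
        hmean, mul_zero]
    have e2 : ∫ ω, |S ω| * Y k ω ^ 2 ∂P = (∫ ω, |S ω| ∂P) * ∫ ω, Y k ω ^ 2 ∂P :=
      hi2.integral_fun_mul_eq_mul_integral hSa.aestronglyMeasurable hYs.aestronglyMeasurable
    have hS3i := h3i hS3
    have hY3i := h3i (h3 k)
    have hadd₁ : Integrable (fun ω => |S ω| ^ 3 + 3 * (S ω * |S ω| * Y k ω)) P :=
      hS3i.add (hm1.const_mul 3)
    have hadd₂ : Integrable (fun ω => |S ω| ^ 3 + 3 * (S ω * |S ω| * Y k ω) +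
        3 * (|S ω| * Y k ω ^ 2)) P := hadd₁.add (hm2.const_mul 3)
    have main : ∫ ω, |∑ i ∈ insert k s, Y i ω| ^ 3 ∂P ≤
        ∫ ω, (|S ω| ^ 3 + 3 * (S ω * |S ω| * Y k ω) + 3 * (|S ω| * Y k ω ^ 2) + |Y k ω| ^ 3) ∂P := by
      refine integral_mono (h3i (memLp_finsetSum _ fun i _ => h3 i))
        (hadd₂.add hY3i) fun ω => ?_
      simp only [Finset.sum_insert hk]
      rw [add_comm (Y k ω)]
      exact abs_add_pow_three_le _ _
    rw [integral_add hadd₂ hY3i, integral_add hadd₁ (hm2.const_mul 3), integral_add hS3i (hm1.const_mul 3), integral_const_mul, integral_const_mul, e1, e2] at main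
    rw [Finset.sum_insert hk, Finset.sum_insert hk]
    nlinarith [mul_le_mul_of_nonneg_right hE hk2]

/-! ### Lower-tail bounds. -/

/-- A centred random variable whose third absolute moment is controlled by its variance takes
values well below zero with a probability bounded away from zero. -/
theorem le_measureReal_le_neg_of_integral_abs_pow_three_le {S : Ω → ℝ} (hS : Measurable S)
    (h3 : MemLp S 3 P) (hmean : ∫ ω, S ω ∂P = 0) {σ K : ℝ} (hσ : 0 < σ) (hK : 0 < K)
    (hvar : ∫ ω, S ω ^ 2 ∂P = σ ^ 2) (hthird : ∫ ω, |S ω| ^ 3 ∂P ≤ K * σ ^ 3) :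
    1 / (16 * K ^ 2) ≤ P.real {ω | S ω ≤ -(σ / (4 * K))} := by
  have h2 : MemLp S 2 P := h3.mono_exponent (by norm_num)
  have hi := h2.integrable one_le_two
  have hia : Integrable (fun ω => |S ω|) P := hi.abs
  have hi3 : Integrable (fun ω => |S ω| ^ 3) P := by
    simpa using h3.integrable_norm_pow (p := 3) (by norm_num)
  set A : Set Ω := {ω | S ω ≤ -(σ / (4 * K))} with hA
  have hAm : MeasurableSet A := measurableSet_le hS measurable_const
  have hiA : Integrable (A.indicator (fun _ => (1 : ℝ))) P := (integrable_const 1).indicator hAm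
  -- Interpolation between first and third moments; the AM-GM weights make the cubic term cost
  -- exactly `σ²/2`.
  have hlow : σ / K ≤ ∫ ω, |S ω| ∂P := by
    have h1 : ∫ ω, S ω ^ 2 ∂P ≤ ∫ ω, (K * σ / 2 * |S ω| + 1 / (2 * K * σ) * |S ω| ^ 3) ∂P := by
      refine integral_mono h2.integrable_sq ((hia.const_mul _).add (hi3.const_mul _)) fun ω => ?_
      have h4 : K * σ / 2 * |S ω| + 1 / (2 * K * σ) * |S ω| ^ 3 - |S ω| ^ 2
          = 1 / (2 * K * σ) * |S ω| * (|S ω| - K * σ) ^ 2 := by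
        field_simp
        ring
      have h5 : 0 ≤ 1 / (2 * K * σ) * |S ω| * (|S ω| - K * σ) ^ 2 := by positivity
      simp only
      rw [← sq_abs]
      linarith
    rw [integral_add (hia.const_mul _) (hi3.const_mul _), integral_const_mul, integral_const_mul,
      hvar] at h1
    have h6 : 1 / (2 * K * σ) * ∫ ω, |S ω| ^ 3 ∂P ≤ 1 / (2 * K * σ) * (K * σ ^ 3) := by gcongr
    have h7 : 1 / (2 * K * σ) * (K * σ ^ 3) = σ ^ 2 / 2 := by field_simp
    rw [div_le_iff₀ hK]
    nlinarith
  have hadd : Integrable (fun ω => 1 / (8 * K * σ) * S ω ^ 2 +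
      2 * K * σ * A.indicator (fun _ => (1 : ℝ)) ω) P :=
    (h2.integrable_sq.const_mul _).add (hiA.const_mul _)
  -- As `S` is centred, its negative part has mean `E|S|/2 ≥ σ/(2K)`. Off `A` it is at most
  -- `σ/(4K)`; on `A`, AM-GM bounds it by the other two terms, the first of mean `σ/(8K)`.
  have hup : ∫ ω, (|S ω| - S ω) / 2 ∂P ≤ ∫ ω, (σ / (4 * K) + (1 / (8 * K * σ) * S ω ^ 2 +
      2 * K * σ * A.indicator (fun _ => (1 : ℝ)) ω)) ∂P := by
    refine integral_mono ((hia.sub hi).div_const 2) ((integrable_const _).add hadd)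
      fun ω => ?_
    simp only
    have hθ : 0 < σ / (4 * K) := by positivity
    have hq : 0 ≤ 1 / (8 * K * σ) * S ω ^ 2 := by positivity
    by_cases hω : ω ∈ A
    · have hneg : S ω ≤ -(σ / (4 * K)) := hω
      rw [Set.indicator_of_mem hω, abs_of_neg (by linarith)]
      have h4 : 1 / (8 * K * σ) * S ω ^ 2 + 2 * K * σ * 1 - (-S ω)
          = 1 / (8 * K * σ) * (S ω + 4 * K * σ) ^ 2 := by
        field_simp
        ring
      have h5 : 0 ≤ 1 / (8 * K * σ) * (S ω + 4 * K * σ) ^ 2 := by positivity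
      linarith
    · have hneg : -(σ / (4 * K)) < S ω := not_le.mp hω
      rw [Set.indicator_of_notMem hω]
      rcases abs_cases (S ω) with ⟨h, _⟩ | ⟨h, _⟩ <;> rw [h] <;> linarith
  rw [integral_div, integral_sub hia hi, hmean, integral_add (integrable_const _) hadd,
    integral_add (h2.integrable_sq.const_mul _) (hiA.const_mul _), integral_const_mul,
    integral_const_mul, hvar, integral_indicator_const _ hAm] at hup
  simp only [integral_const, probReal_univ, smul_eq_mul, mul_one, sub_zero] at hup
  have h8 : 1 / (8 * K * σ) * σ ^ 2 = σ / K / 8 := by field_simp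
  have h9 : σ / (4 * K) = σ / K / 4 := by field_simp
  rw [h8, h9] at hup
  have h10 : σ / K / 8 ≤ 2 * K * σ * P.real A := by linarith
  have h11 : σ / K / 8 = 2 * K * σ * (1 / (16 * K ^ 2)) := by field_simp; norm_num
  rw [h11] at h10
  exact le_of_mul_le_mul_left h10 (by positivity)

theorem exists_le_measureReal_ge_of_measure_pos {Y : Ω → ℝ} (h : 0 < P {ω | 0 < Y ω}) :
    ∃ δ : ℝ, 0 < δ ∧ δ ≤ P.real {ω | δ ≤ Y ω} := by
  have hU : {ω | 0 < Y ω} = ⋃ n : ℕ, {ω | 1 / ((n : ℝ) + 1) ≤ Y ω} := by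
    ext ω
    simp only [Set.mem_ofPred_eq, Set.mem_iUnion]
    exact ⟨fun hω => (exists_nat_one_div_lt hω).imp fun n hn => hn.le,
      fun ⟨n, hn⟩ => lt_of_lt_of_le (by positivity) hn⟩
  rw [hU] at h
  obtain ⟨n, hn⟩ := exists_measure_pos_of_not_measure_iUnion_null h.ne'
  have hn' : 0 < P.real {ω | 1 / ((n : ℝ) + 1) ≤ Y ω} :=
    ENNReal.toReal_pos hn.ne' (measure_ne_top _ _)
  refine ⟨min (1 / ((n : ℝ) + 1)) (P.real {ω | 1 / ((n : ℝ) + 1) ≤ Y ω}),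
    lt_min (by positivity) hn', (min_le_right _ _).trans ?_⟩
  refine measureReal_mono fun ω hω => ?_
  rw [Set.mem_ofPred_eq] at hω ⊢
  exact (min_le_left _ _).trans hω

/-- The sign of `t` selects which half of `hna` produces the loss; one `δ` serves as both loss rate
and probability. -/
theorem exists_forall_lt_le_measureReal {ε : ℕ → Ω → ℝ} {b : ℕ → ℝ}
    (hna : ∀ i, 0 < P {ω | b i < ε i ω} ∧ 0 < P {ω | ε i ω < b i}) (N : ℕ) :
    ∃ δ : ℝ, 0 < δ ∧ ∀ i < N, ∀ t : ℝ, δ ≤ P.real {ω | t * (ε i ω - b i) ≤ -(δ * |t|)} := by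
  have hone : ∀ i, ∃ δ : ℝ, 0 < δ ∧
      δ ≤ P.real {ω | δ ≤ ε i ω - b i} ∧ δ ≤ P.real {ω | δ ≤ b i - ε i ω} := by
    intro i
    obtain ⟨δ₁, h₁, h₁'⟩ := exists_le_measureReal_ge_of_measure_pos
      (P := P) (Y := fun ω => ε i ω - b i) (by simpa using (hna i).1)
    obtain ⟨δ₂, h₂, h₂'⟩ := exists_le_measureReal_ge_of_measure_pos
      (P := P) (Y := fun ω => b i - ε i ω) (by simpa using (hna i).2)
    exact ⟨min δ₁ δ₂, lt_min h₁ h₂,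
      (min_le_left _ _).trans (h₁'.trans (measureReal_mono
        (Set.ofPred_subset_ofPred.mpr fun ω hω => (min_le_left _ _).trans hω))),
      (min_le_right _ _).trans (h₂'.trans (measureReal_mono
        (Set.ofPred_subset_ofPred.mpr fun ω hω => (min_le_right _ _).trans hω)))⟩
  choose d hd hd₁ hd₂ using hone
  have hmin : ∃ δ : ℝ, 0 < δ ∧ ∀ i < N, δ ≤ d i := by
    induction N with
    | zero => exact ⟨1, one_pos, by simp⟩
    | succ N ih =>
      obtain ⟨δ, hδ, h⟩ := ih
      refine ⟨min δ (d N), lt_min hδ (hd N), fun i hi => ?_⟩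
      rcases Nat.lt_succ_iff_lt_or_eq.mp hi with hi | rfl
      · exact (min_le_left _ _).trans (h i hi)
      · exact min_le_right _ _
  obtain ⟨δ, hδ, h⟩ := hmin
  refine ⟨δ, hδ, fun i hi t => ?_⟩
  have hle := h i hi
  rcases le_total 0 t with ht | ht
  · refine (hle.trans (hd₂ i)).trans (measureReal_mono fun ω hω => ?_)
    simp only [Set.mem_ofPred_eq] at hω ⊢
    rw [abs_of_nonneg ht]
    nlinarith
  · refine (hle.trans (hd₁ i)).trans (measureReal_mono fun ω hω => ?_)
    simp only [Set.mem_ofPred_eq] at hω ⊢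
    rw [abs_of_nonpos ht]
    nlinarith


/-! ### Finite portfolios. -/

theorem integral_abs_sum_mul_pow_three_le {ε : ℕ → Ω → ℝ} (hmeas : ∀ i, Measurable (ε i))
    (h3 : ∀ i, MemLp (ε i) 3 P) (hind : iIndepFun ε P) (hmean : ∀ i, ∫ ω, ε i ω ∂P = 0)
    (hvar : ∀ i, ∫ ω, ε i ω ^ 2 ∂P = 1) {M : ℝ} (hM : ∀ i, ∫ ω, |ε i ω| ^ 3 ∂P ≤ M)
    (h : ℕ → ℝ) (s : Finset ℕ) :
    ∫ ω, ∑ i ∈ s, h i * ε i ω ∂P = 0 ∧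
    ∫ ω, (∑ i ∈ s, h i * ε i ω) ^ 2 ∂P = √(∑ i ∈ s, h i ^ 2) ^ 2 ∧
    ∫ ω, |∑ i ∈ s, h i * ε i ω| ^ 3 ∂P ≤ (3 + M) * √(∑ i ∈ s, h i ^ 2) ^ 3 := by
  have hY3 : ∀ i, MemLp (fun ω => h i * ε i ω) 3 P := fun i => (h3 i).const_mul _
  have hYm : ∀ i, Measurable (fun ω => h i * ε i ω) := fun i => (hmeas i).const_mul _
  have hYind : iIndepFun (fun i ω => h i * ε i ω) P :=
    hind.comp (fun i x => h i * x) fun i => measurable_const_mul _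
  have hY0 : ∀ i, ∫ ω, h i * ε i ω ∂P = 0 := fun i => by rw [integral_const_mul, hmean, mul_zero]
  have hYv : ∀ i, ∫ ω, (h i * ε i ω) ^ 2 ∂P = h i ^ 2 := fun i => by
    simp_rw [mul_pow]
    rw [integral_const_mul, hvar, mul_one]
  have hY2 : ∀ i, MemLp (fun ω => h i * ε i ω) 2 P := fun i => (hY3 i).mono_exponent (by norm_num)
  have hnn : 0 ≤ ∑ i ∈ s, h i ^ 2 := Finset.sum_nonneg fun i _ => sq_nonneg _
  have hM0 : 0 ≤ M := le_trans (integral_nonneg fun ω => by positivity) (hM 0)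
  have hsq := Real.sq_sqrt hnn
  set σ := √(∑ i ∈ s, h i ^ 2) with hσ
  have hσ0 : 0 ≤ σ := Real.sqrt_nonneg _
  refine ⟨?_, ?_, ?_⟩
  · rw [integral_finsetSum _ fun i _ => (hY2 i).integrable one_le_two]
    simp [hY0]
  · rw [integral_sum_sq_of_iIndepFun hY2 hYind hY0, hsq]
    simp_rw [hYv]
  · have key := integral_abs_sum_pow_three_le hYm hY3 hYind hY0 hσ0 s (by simp_rw [hYv, hsq]; rfl)
    simp_rw [hYv] at key
    have hthree : ∑ i ∈ s, ∫ ω, |h i * ε i ω| ^ 3 ∂P ≤ ∑ i ∈ s, M * σ * h i ^ 2 := by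
      refine Finset.sum_le_sum fun i hi => ?_
      simp_rw [abs_mul, mul_pow]
      rw [integral_const_mul]
      -- This turns `∑ |h i|³` into at most `σ³`.
      have hle : |h i| ≤ σ :=
        Real.abs_le_sqrt (Finset.single_le_sum (f := fun i => h i ^ 2)
          (fun i _ => sq_nonneg _) hi)
      calc |h i| ^ 3 * ∫ ω, |ε i ω| ^ 3 ∂P ≤ |h i| ^ 3 * M := by gcongr; exact hM i
        _ = M * |h i| * h i ^ 2 := by rw [← sq_abs (h i)]; ring
        _ ≤ M * σ * h i ^ 2 := by gcongr
    rw [← Finset.mul_sum, ← hsq] at hthree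
    rw [← hsq] at key
    nlinarith

theorem le_measureReal_sum_mul_sub_le {ε : ℕ → Ω → ℝ} {b : ℕ → ℝ}
    (hmeas : ∀ i, Measurable (ε i))
    (h3 : ∀ i, MemLp (ε i) 3 P) (hind : iIndepFun ε P) (hmean : ∀ i, ∫ ω, ε i ω ∂P = 0)
    (hvar : ∀ i, ∫ ω, ε i ω ^ 2 ∂P = 1) {M : ℝ} (hM : ∀ i, ∫ ω, |ε i ω| ^ 3 ∂P ≤ M)
    (h : ℕ → ℝ) (s : Finset ℕ) (hb : ∑ i ∈ s, b i ^ 2 ≤ (1 / (8 * (3 + M))) ^ 2) :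
    1 / (16 * (3 + M) ^ 2) ≤ P.real {ω | ∑ i ∈ s, h i * (ε i ω - b i) ≤
      -(1 / (8 * (3 + M)) * √(∑ i ∈ s, h i ^ 2))} := by
  obtain ⟨e1, e2, e3⟩ := integral_abs_sum_mul_pow_three_le hmeas h3 hind hmean hvar hM h s
  have hM0 : 0 ≤ M := le_trans (integral_nonneg fun ω => by positivity) (hM 0)
  have hnn : 0 ≤ ∑ i ∈ s, h i ^ 2 := Finset.sum_nonneg fun i _ => sq_nonneg _
  have hK : 0 < 3 + M := by linarith
  rcases hnn.eq_or_lt with h0 | hpos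
  · have hz : ∀ i ∈ s, h i = 0 := fun i hi => by
      simpa using (Finset.sum_eq_zero_iff_of_nonneg fun i _ => sq_nonneg (h i)).mp h0.symm i hi
    have hall : {ω | ∑ i ∈ s, h i * (ε i ω - b i) ≤
        -(1 / (8 * (3 + M)) * √(∑ i ∈ s, h i ^ 2))} = Set.univ := by
      refine Set.eq_univ_of_forall fun ω => ?_
      rw [Set.mem_ofPred_eq, ← h0, Finset.sum_eq_zero fun i hi => by rw [hz i hi, zero_mul]]
      simp
    rw [hall, probReal_univ, div_le_one (by positivity)]
    nlinarith
  · have hσ : 0 < √(∑ i ∈ s, h i ^ 2) := Real.sqrt_pos.mpr hpos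
    refine (le_measureReal_le_neg_of_integral_abs_pow_three_le
      (Finset.measurable_sum s fun i _ => (hmeas i).const_mul (h i))
      (memLp_finsetSum s fun i _ => (h3 i).const_mul (h i)) e1 hσ hK e2 e3).trans
      (measureReal_mono (Set.ofPred_subset_ofPred.mpr fun ω hω => ?_))
    -- The drift costs at most half of the loss `σ/(4K)`.
    have hcs : |∑ i ∈ s, h i * b i| ≤ √(∑ i ∈ s, h i ^ 2) * (1 / (8 * (3 + M))) := by
      refine abs_le_of_sq_le_sq ?_ (by positivity)
      rw [mul_pow, Real.sq_sqrt hnn]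
      exact (Finset.sum_mul_sq_le_sq_mul_sq s h b).trans (by gcongr)
    have hdiv : √(∑ i ∈ s, h i ^ 2) / (4 * (3 + M)) =
        2 * (√(∑ i ∈ s, h i ^ 2) * (1 / (8 * (3 + M)))) := by
      field_simp; norm_num
    simp_rw [mul_sub, Finset.sum_sub_distrib]
    have := neg_abs_le (∑ i ∈ s, h i * b i)
    rw [hdiv] at hω
    linarith

/-- Uniform lower bound for the probability that a finite portfolio loses a fixed fraction of the
Euclidean norm of its strategy. -/
theorem exists_forall_le_measureReal_sum_range {ε : ℕ → Ω → ℝ} {b : ℕ → ℝ}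
    (hmeas : ∀ i, Measurable (ε i))
    (h3 : ∀ i, MemLp (ε i) 3 P) (hind : iIndepFun ε P) (hmean : ∀ i, ∫ ω, ε i ω ∂P = 0)
    (hvar : ∀ i, ∫ ω, ε i ω ^ 2 ∂P = 1) {M : ℝ} (hM : ∀ i, ∫ ω, |ε i ω| ^ 3 ∂P ≤ M)
    (hb : Summable fun i => b i ^ 2)
    (hna : ∀ i, 0 < P {ω | b i < ε i ω} ∧ 0 < P {ω | ε i ω < b i}) :
    ∃ c p : ℝ, 0 < c ∧ 0 < p ∧ ∃ N, ∀ n ≥ N, ∀ h : ℕ → ℝ,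
      p ≤ P.real {ω | ∑ i ∈ Finset.range n, h i * (ε i ω - b i) ≤
        -(c * √(∑ i ∈ Finset.range n, h i ^ 2))} := by
  have hM0 : 0 ≤ M := le_trans (integral_nonneg fun ω => by positivity) (hM 0)
  set η : ℝ := 1 / (8 * (3 + M)) with hη
  have hη0 : 0 < η := by positivity
  obtain ⟨s₀, hs₀⟩ := summable_iff_vanishing_norm.mp hb (η ^ 2) (by positivity)
  obtain ⟨N, hN⟩ := s₀.exists_nat_subset_range
  obtain ⟨δ, hδ, hhead⟩ := exists_forall_lt_le_measureReal hna N
  refine ⟨min δ η, δ ^ N * (1 / (16 * (3 + M) ^ 2)), lt_min hδ hη0, by positivity, N,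
    fun n hn h => ?_⟩
  have hdisj : Disjoint (Finset.range N) (Finset.Ico N n) := by
    rw [Finset.range_eq_Ico]; exact Finset.Ico_disjoint_Ico_consecutive 0 N n
  have hb' : ∑ i ∈ Finset.Ico N n, b i ^ 2 ≤ η ^ 2 :=
    (Real.le_norm_self _).trans (hs₀ _ (hdisj.symm.mono_right hN)).le
  have htail := le_measureReal_sum_mul_sub_le hmeas h3 hind hmean hvar hM h (Finset.Ico N n) hb'
  have hB : ∀ i, MeasurableSet {x : ℝ | h i * (x - b i) ≤ -(δ * |h i|)} := fun i =>
    measurableSet_le (by fun_prop) measurable_const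
  have hhd := pow_card_le_measureReal_forall_mem hind (Finset.range N)
    (B := fun i => {x : ℝ | h i * (x - b i) ≤ -(δ * |h i|)}) hB hδ.le
    fun i hi => hhead i (Finset.mem_range.mp hi) (h i)
  rw [Finset.card_range] at hhd
  -- Losses in the head (indices below `N`) and in the tail are independent, so they occur together
  -- with at least the product probability.
  have hI := (hind.indepFun_finset _ _ hdisj hmeas).measure_inter_preimage_eq_mul
    {x : Finset.range N → ℝ | ∀ i : Finset.range N, x i ∈ {x : ℝ | h i * (x - b i) ≤ -(δ * |h i|)}}
    {x : Finset.Ico N n → ℝ | ∑ i : Finset.Ico N n, h i * (x i - b i) ≤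
      -(η * √(∑ i ∈ Finset.Ico N n, h i ^ 2))}
    (by
      rw [Set.ofPred_forall]
      exact MeasurableSet.iInter fun i => measurable_pi_apply i (hB i.1))
    (measurableSet_le (by fun_prop) measurable_const)
  have hpre₁ : (fun ω (i : Finset.range N) => ε i ω) ⁻¹'
      {x : Finset.range N → ℝ | ∀ i : Finset.range N, x i ∈ {x : ℝ | h i * (x - b i) ≤ -(δ * |h i|)}} =
      {ω | ∀ i ∈ Finset.range N, ε i ω ∈ {x : ℝ | h i * (x - b i) ≤ -(δ * |h i|)}} := by
    ext ω
    simp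
  have hpre₂ : (fun ω (i : Finset.Ico N n) => ε i ω) ⁻¹'
      {x : Finset.Ico N n → ℝ | ∑ i : Finset.Ico N n, h i * (x i - b i) ≤
        -(η * √(∑ i ∈ Finset.Ico N n, h i ^ 2))} =
      {ω | ∑ i ∈ Finset.Ico N n, h i * (ε i ω - b i) ≤
        -(η * √(∑ i ∈ Finset.Ico N n, h i ^ 2))} := by
    ext ω
    simp only [Set.mem_preimage, Set.mem_ofPred_eq]
    rw [Finset.sum_coe_sort (Finset.Ico N n) fun i => h i * (ε i ω - b i)]
  rw [hpre₁, hpre₂] at hI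
  have hI' := congrArg ENNReal.toReal hI
  rw [ENNReal.toReal_mul, ← measureReal_def, ← measureReal_def, ← measureReal_def] at hI'
  have hprod : δ ^ N * (1 / (16 * (3 + M) ^ 2)) ≤ _ :=
    mul_le_mul hhd htail (by positivity) measureReal_nonneg
  rw [← hI'] at hprod
  refine hprod.trans (measureReal_mono fun ω hω => ?_)
  obtain ⟨hω₁, hω₂⟩ := hω
  simp only [Set.mem_ofPred_eq] at hω₁ hω₂ ⊢
  rw [← Finset.sum_range_add_sum_Ico _ hn, ← Finset.sum_range_add_sum_Ico _ hn]
  have hnn₁ : 0 ≤ ∑ i ∈ Finset.range N, h i ^ 2 := Finset.sum_nonneg fun i _ => sq_nonneg _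
  have hnn₂ : 0 ≤ ∑ i ∈ Finset.Ico N n, h i ^ 2 := Finset.sum_nonneg fun i _ => sq_nonneg _
  have hsum₁ : ∑ i ∈ Finset.range N, h i * (ε i ω - b i) ≤
      -(δ * √(∑ i ∈ Finset.range N, h i ^ 2)) := by
    have hle := Finset.sum_le_sum hω₁
    rw [Finset.sum_neg_distrib, ← Finset.mul_sum] at hle
    -- The head loss is measured in `ℓ¹`, which dominates `ℓ²`.
    have hl1 : √(∑ i ∈ Finset.range N, h i ^ 2) ≤ ∑ i ∈ Finset.range N, |h i| := by
      rw [Real.sqrt_le_left (Finset.sum_nonneg fun i _ => abs_nonneg _)]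
      simp_rw [← sq_abs (h _)]
      exact Finset.sum_sq_le_sq_sum_of_nonneg fun i _ => abs_nonneg _
    nlinarith [mul_le_mul_of_nonneg_left hl1 hδ.le]
  have hsqrt : √(∑ i ∈ Finset.range N, h i ^ 2 + ∑ i ∈ Finset.Ico N n, h i ^ 2) ≤
      √(∑ i ∈ Finset.range N, h i ^ 2) + √(∑ i ∈ Finset.Ico N n, h i ^ 2) :=
    Real.sqrt_le_iff.mpr ⟨by positivity, by
      rw [add_sq, Real.sq_sqrt hnn₁, Real.sq_sqrt hnn₂]
      linarith [mul_nonneg (Real.sqrt_nonneg (∑ i ∈ Finset.range N, h i ^ 2))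
        (Real.sqrt_nonneg (∑ i ∈ Finset.Ico N n, h i ^ 2))]⟩
  have hm : 0 < min δ η := lt_min hδ hη0
  have := mul_le_mul_of_nonneg_left hsqrt hm.le
  have := mul_le_mul_of_nonneg_right (min_le_left δ η)
    (Real.sqrt_nonneg (∑ i ∈ Finset.range N, h i ^ 2))
  have := mul_le_mul_of_nonneg_right (min_le_right δ η)
    (Real.sqrt_nonneg (∑ i ∈ Finset.Ico N n, h i ^ 2))
  linarith

/-! ### Infinite portfolios. -/

theorem exists_isPortfolioValue {ε : ℕ → Ω → ℝ} {b : ℕ → ℝ}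
    (hsq : ∀ i, MemLp (ε i) 2 P) (hind : iIndepFun ε P) (hmean : ∀ i, ∫ ω, ε i ω ∂P = 0)
    (hvar : ∀ i, ∫ ω, ε i ω ^ 2 ∂P = 1) (hb : Summable fun i => b i ^ 2) {h : ℕ → ℝ}
    (hh : Summable fun i => h i ^ 2) : ∃ V : Ω → ℝ, IsPortfolioValue P ε b h V := by
  have hF : ∀ i, MemLp (fun ω => h i * (ε i ω - b i)) 2 P := fun i =>
    ((hsq i).sub (memLp_const (b i))).const_mul (h i)
  have hone : MemLp (fun _ : Ω => (1 : ℝ)) 2 P := memLp_const 1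
  have hS : ∀ n, MemLp (fun ω => ∑ i ∈ Finset.range n, h i * (ε i ω - b i)) 2 P := fun n =>
    memLp_finsetSum _ fun i _ => hF i
  have honv : Orthonormal ℝ fun i => (hsq i).toLp (ε i) := by
    rw [orthonormal_iff_ite]
    intro i j
    have hinner : inner ℝ ((hsq i).toLp (ε i)) ((hsq j).toLp (ε j)) =
        ∫ ω, ε i ω * ε j ω ∂P := by
      rw [L2.inner_def]
      refine integral_congr_ae ?_
      filter_upwards [(hsq i).coeFn_toLp, (hsq j).coeFn_toLp] with ω hi hj
      rw [hi, hj]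
      simp [mul_comm]
    rw [hinner]
    split_ifs with hij
    · subst hij
      simpa [sq] using hvar i
    · rw [(hind.indepFun hij).integral_fun_mul_eq_mul_integral (hsq i).aestronglyMeasurable
        (hsq j).aestronglyMeasurable, hmean, zero_mul]
  have hsum₁ : Summable fun i => h i • (hsq i).toLp (ε i) :=
    (honv.orthogonalFamily.summable_iff_norm_sq_summable h).mpr (by simpa using hh)
  have hhb : Summable fun i => h i * b i := by
    refine Summable.of_norm_bounded (hh.add hb) fun i => ?_
    rw [Real.norm_eq_abs, abs_mul, ← sq_abs (h i), ← sq_abs (b i)]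
    nlinarith [sq_nonneg (|h i| - |b i|), mul_nonneg (abs_nonneg (h i)) (abs_nonneg (b i))]
  have hsum₂ : Summable fun i => (h i * b i) • hone.toLp (fun _ => (1 : ℝ)) :=
    hhb.smul_const _
  have hpart : ∀ n, (hS n).toLp _ = ∑ i ∈ Finset.range n, (h i • (hsq i).toLp (ε i) -
      (h i * b i) • hone.toLp (fun _ => (1 : ℝ))) := by
    intro n
    induction n with
    | zero =>
      simp only [Finset.range_zero, Finset.sum_empty]
      exact MemLp.toLp_zero _
    | succ n ih =>
      rw [Finset.sum_range_succ, ← ih, ← MemLp.toLp_const_smul, ← MemLp.toLp_const_smul,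
        ← MemLp.toLp_sub, ← MemLp.toLp_add]
      congr 1
      ext ω
      simp [Finset.sum_range_succ, mul_sub]
      ring
  obtain ⟨W, hW⟩ := hsum₁.sub hsum₂
  have htend := hW.tendsto_sum_nat
  simp_rw [← hpart] at htend
  refine ⟨W, Lp.memLp W, ?_⟩
  rw [Lp.tendsto_Lp_iff_tendsto_eLpNorm'] at htend
  refine htend.congr fun n => eLpNorm_congr_ae ?_
  filter_upwards [(hS n).coeFn_toLp] with ω hω
  rw [Pi.sub_apply, hω]

omit [IsProbabilityMeasure P] in
theorem IsPortfolioValue.const_mul {ε : ℕ → Ω → ℝ} {b h : ℕ → ℝ} {V : Ω → ℝ}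
    (hV : IsPortfolioValue P ε b h V) (c : ℝ) :
    IsPortfolioValue P ε b (fun i => c * h i) fun ω => c * V ω := by
  refine ⟨hV.1.const_mul c, ?_⟩
  have := ENNReal.Tendsto.const_mul (a := ‖c‖ₑ) hV.2 (Or.inr enorm_ne_top)
  rw [mul_zero] at this
  refine this.congr fun n => ?_
  rw [← eLpNorm_const_smul]
  congr 1
  ext ω
  simp only [Pi.smul_apply, smul_eq_mul, mul_sub, Finset.mul_sum, mul_assoc]

/-- One good truncation suffices: its strategy has norm at least `1/2`, so it loses at least `c/2`
with probability at least `p`, while it differs from `V` by `c/8` or more with probability below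
`p/2`. -/
theorem le_measureReal_lt_of_isPortfolioValue {ε : ℕ → Ω → ℝ} {b h : ℕ → ℝ} {V : Ω → ℝ}
    (hmeas : ∀ i, Measurable (ε i)) (hV : IsPortfolioValue P ε b h V) {c p : ℝ}
    (hc : 0 < c) (hp : 0 < p) {N : ℕ}
    (hlow : ∀ n ≥ N, p ≤ P.real {ω | ∑ i ∈ Finset.range n, h i * (ε i ω - b i) ≤
        -(c * √(∑ i ∈ Finset.range n, h i ^ 2))})
    (hh : HasSum (fun i => h i ^ 2) 1) :
    p / 2 ≤ P.real {ω | V ω < -(c / 4)} := by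
  have hSm : ∀ n, Measurable fun ω => ∑ i ∈ Finset.range n, h i * (ε i ω - b i) := fun n =>
    Finset.measurable_sum _ fun i _ => ((hmeas i).sub_const _).const_mul _
  have hmeasure : TendstoInMeasure P
      (fun (n : ℕ) ω => ∑ i ∈ Finset.range n, h i * (ε i ω - b i)) atTop V :=
    tendstoInMeasure_of_tendsto_eLpNorm two_ne_zero (fun n => (hSm n).aestronglyMeasurable)
      hV.1.aestronglyMeasurable hV.2
  rw [tendstoInMeasure_iff_measureReal_norm] at hmeasure
  have hsmall := (hmeasure (c / 8) (by positivity)).eventually_lt_const (half_pos hp)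
  have hnorm : ∀ᶠ n in atTop, 1 / 4 < ∑ i ∈ Finset.range n, h i ^ 2 :=
    hh.tendsto_sum_nat.eventually_const_lt (by norm_num)
  obtain ⟨n, hn₁, hn₂, hn₃⟩ := (hsmall.and (hnorm.and (eventually_ge_atTop N))).exists
  have hsqrt : 1 / 2 ≤ √(∑ i ∈ Finset.range n, h i ^ 2) :=
    Real.le_sqrt_of_sq_le (by norm_num; linarith)
  have hsub : {ω | ∑ i ∈ Finset.range n, h i * (ε i ω - b i) ≤
      -(c * √(∑ i ∈ Finset.range n, h i ^ 2))} ⊆ {ω | V ω < -(c / 4)} ∪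
      {ω | c / 8 ≤ ‖∑ i ∈ Finset.range n, h i * (ε i ω - b i) - V ω‖} := by
    intro ω hω
    rw [Set.mem_union, Set.mem_ofPred_eq, Set.mem_ofPred_eq]
    rw [Set.mem_ofPred_eq] at hω
    by_contra! hcon
    have := (abs_lt.mp hcon.2).1
    nlinarith [mul_le_mul_of_nonneg_left hsqrt hc.le]
  have := (hlow n hn₃).trans ((measureReal_mono hsub).trans (measureReal_union_le _ _))
  linarith

theorem exists_quantitativeNoArbitrage {ε : ℕ → Ω → ℝ} {b : ℕ → ℝ}
    (hmeas : ∀ i, Measurable (ε i))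
    (h3 : ∀ i, MemLp (ε i) 3 P) (hind : iIndepFun ε P) (hmean : ∀ i, ∫ ω, ε i ω ∂P = 0)
    (hvar : ∀ i, ∫ ω, ε i ω ^ 2 ∂P = 1) {M : ℝ} (hM : ∀ i, ∫ ω, |ε i ω| ^ 3 ∂P ≤ M)
    (hb : Summable fun i => b i ^ 2)
    (hna : ∀ i, 0 < P {ω | b i < ε i ω} ∧ 0 < P {ω | ε i ω < b i}) :
    ∃ α : ℝ, 0 < α ∧ QuantitativeNoArbitrage P ε b α := by
  obtain ⟨c, p, hc, hp, N, hN⟩ :=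
    exists_forall_le_measureReal_sum_range hmeas h3 hind hmean hvar hM hb hna
  -- `p / 4` rather than `p / 2`, for a strict inequality.
  refine ⟨min (c / 4) (p / 4), by positivity, fun h hh V hV => ?_⟩
  have hsum : HasSum (fun i => h i ^ 2) 1 := by
    have := lp.hasSum_norm (p := 2) (by norm_num) h
    simpa [hh] using this
  have hle := le_measureReal_lt_of_isPortfolioValue hmeas hV hc hp (fun n hn => hN n hn h) hsum
  calc min (c / 4) (p / 4) ≤ p / 4 := min_le_right _ _
    _ < p / 2 := by linarith
    _ ≤ P.real {ω | V ω < -(c / 4)} := hle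
    _ ≤ _ := measureReal_mono (Set.ofPred_subset_ofPred.mpr fun ω hω =>
      hω.trans_le (neg_le_neg (min_le_left _ _)))

omit [IsProbabilityMeasure P] in
theorem QuantitativeNoArbitrage.norm_le {ε : ℕ → Ω → ℝ} {b : ℕ → ℝ} {α : ℝ} (hα : 0 < α)
    (hq : QuantitativeNoArbitrage P ε b α) (y : ℝ) (h : lp (fun _ : ℕ => ℝ) 2) {V : Ω → ℝ}
    (hV : IsPortfolioValue P ε b h V) (hy : ∀ᵐ ω ∂P, 0 ≤ y + V ω) : ‖h‖ ≤ |y| / α := by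
  rcases eq_or_ne h 0 with rfl | hne
  · rw [norm_zero]
    positivity
  have hpos : 0 < ‖h‖ := norm_pos_iff.mpr hne
  have hpr := hq (‖h‖⁻¹ • h) (norm_smul_inv_norm (𝕜 := ℝ) hne) _ (hV.const_mul ‖h‖⁻¹)
  by_contra! hlt
  rw [div_lt_iff₀ hα] at hlt
  -- There `V < -α‖h‖ < -|y|`, so `y + V < 0`.
  have hzero : P {ω | ‖h‖⁻¹ * V ω < -α} = 0 := by
    refine measure_mono_null (fun ω hω => ?_) (ae_iff.mp hy)
    rw [Set.mem_ofPred_eq, inv_mul_lt_iff₀ hpos] at hω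
    rw [Set.mem_ofPred_eq, not_le]
    have := le_abs_self y
    linarith
  rw [measureReal_def, hzero, ENNReal.toReal_zero] at hpr
  exact lt_asymm hα hpr

omit [IsProbabilityMeasure P] in
theorem memLp_three_and_exists_integral_abs_pow_three_le {ε : ℕ → Ω → ℝ}
    (hmeas : ∀ i, Measurable (ε i))
    (hthird : (⨆ i, ∫⁻ ω, ENNReal.ofReal (|ε i ω| ^ 3) ∂P) < (⊤ : ℝ≥0∞)) :
    (∀ i, MemLp (ε i) 3 P) ∧ ∃ M : ℝ, ∀ i, ∫ ω, |ε i ω| ^ 3 ∂P ≤ M := by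
  have hle := fun i => le_iSup (fun i => ∫⁻ ω, ENNReal.ofReal (|ε i ω| ^ 3) ∂P) i
  refine ⟨fun i => ?_, (⨆ i, ∫⁻ ω, ENNReal.ofReal (|ε i ω| ^ 3) ∂P).toReal, fun i => ?_⟩
  · rw [← integrable_norm_rpow_iff (hmeas i).aestronglyMeasurable (by norm_num) (by norm_num)]
    refine ⟨((hmeas i).norm.pow_const _).aestronglyMeasurable, ?_⟩
    rw [hasFiniteIntegral_iff_ofReal (ae_of_all _ fun ω => by positivity)]
    refine lt_of_le_of_lt (le_of_eq ?_) ((hle i).trans_lt hthird)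
    simp
  · rw [integral_eq_lintegral_of_nonneg_ae (ae_of_all _ fun ω => by positivity)
      (by have := hmeas i; fun_prop)]
    exact ENNReal.toReal_mono hthird.ne (hle i)

end

theorem proposition2 {Ω : Type*} [MeasurableSpace Ω] (P : Measure Ω) [IsProbabilityMeasure P]
    (ε : ℕ → Ω → ℝ) (b : ℕ → ℝ)
    (hmeas : ∀ i, Measurable (ε i))
    (hsq : ∀ i, MemLp (ε i) 2 P)
    (hindep : iIndepFun ε P)
    (hmean : ∀ i, ∫ ω, ε i ω ∂P = 0)
    (hvar : ∀ i, ∫ ω, (ε i ω) ^ 2 ∂P = 1)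
    (hb : Memℓp b 2)
    (hna : ∀ i, 0 < P {ω | b i < ε i ω} ∧ 0 < P {ω | ε i ω < b i})
    (hthird : (⨆ i, ∫⁻ ω, ENNReal.ofReal (|ε i ω| ^ 3) ∂P) < (⊤ : ℝ≥0∞)) :
    (∀ h : lp (fun _ : ℕ => ℝ) 2, ∃ V : Ω → ℝ, IsPortfolioValue P ε b h V) ∧
    (∃ α : ℝ, 0 < α ∧ QuantitativeNoArbitrage P ε b α) ∧
    (∀ α : ℝ, 0 < α → QuantitativeNoArbitrage P ε b α →
      ∀ (y : ℝ) (h : lp (fun _ : ℕ => ℝ) 2) (V : Ω → ℝ), IsPortfolioValue P ε b h V →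
        (∀ᵐ ω ∂P, 0 ≤ y + V ω) → ‖h‖ ≤ |y| / α) := by
  have hb' : Summable fun i => b i ^ 2 := by
    simpa using hb.summable (by norm_num)
  obtain ⟨h3, M, hM⟩ := memLp_three_and_exists_integral_abs_pow_three_le hmeas hthird
  refine ⟨fun h => ?_, ?_, fun α hα hq y h V hV hy => hq.norm_le hα y h hV hy⟩
  · exact exists_isPortfolioValue hsq hindep hmean hvar hb'
      (by simpa using (lp.memℓp h).summable (by norm_num))
  · exact exists_quantitativeNoArbitrage hmeas h3 hindep hmean hvar hM hb' hna
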